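/- For a simple graph $G$ with $n$ vertices, let $Q(G)=D(G)+A(G)$ be its signless Laplacian matrix, where $D(G)$ is the diagonal matrix of the vertex degrees and $A(G)$ the adjacency matrix, let $q_1(G)\ge q_2(G)\ge\cdots\ge q_n(G)$ be the eigenvalues of $Q(G)$ with multiplicity, and let $\overline{G}$ be the complement of $G$. Theorem. Let $G$ be a connected bipartite graph of order $n\ge 6$. Then $$q_2(G)+q_2(\overline{G})\le 2n-5,$$ and equality holds if and only if $G$ is isomorphic to one of the following nine graphs of order $6$: the complete bipartite graph $K_{3,3}$, or one of the graphs $H_1,\dots,H_8$ on the vertex set $\{0,1,2,3,4,5\}$ with edge sets (writing $ij$ for the edge $\{i,j\}$) - $E(H_1)=\{03,04,14,15,25\}$, - $E(H_2)=\{03,04,05,13,23\}$, - $E(H_3)=\{03,04,13,14,15,25\}$, - $E(H_4)=\{03,04,13,14,15,24\}$, - $E(H_5)=\{04,05,13,15,23,24\}$, - $E(H_6)=\{03,04,13,14,23,24,25\}$, - $E(H_7)=\{03,04,13,14,15,24,25\}$, - $E(H_8)=\{03,04,05,13,14,15,23,24\}$. -/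

import Mathlib

namespace SignlessLaplacian

/-- The signless Laplacian matrix `Q(G) = D(G) + A(G)` of a finite simple graph. -/
def signlessLapMatrix {V : Type*} [Fintype V] [DecidableEq V] (G : SimpleGraph V)
    [DecidableRel G.Adj] : Matrix V V ℝ :=
  G.degMatrix ℝ + G.adjMatrix ℝ

theorem isHermitian_signlessLapMatrix {V : Type*} [Fintype V] [DecidableEq V]
    (G : SimpleGraph V) [DecidableRel G.Adj] : (signlessLapMatrix G).IsHermitian :=
  (G.isHermitian_degMatrix ℝ).add (G.isHermitian_adjMatrix ℝ)

/-- The signless Laplacian eigenvalues of `G`, with multiplicity, in weakly decreasing order.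
The indexing starts at `0`, so the value at `k` is the `(k + 1)`-st largest eigenvalue. -/
noncomputable def qEigenvalues {V : Type*} [Fintype V] [DecidableEq V] (G : SimpleGraph V)
    [DecidableRel G.Adj] : Fin (Fintype.card V) → ℝ :=
  (isHermitian_signlessLapMatrix G).eigenvalues₀

/-- The second largest signless Laplacian eigenvalue `q₂(G)` of a graph on at least two
vertices. -/
noncomputable def q₂ {V : Type*} [Fintype V] [DecidableEq V] (G : SimpleGraph V)
    [DecidableRel G.Adj] (h : 1 < Fintype.card V) : ℝ :=
  qEigenvalues G ⟨1, h⟩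

/-! Eight bipartite graphs on the vertex set `{0, 1, 2} ∪ {3, 4, 5}`
(upper row `0, 1, 2` and lower row `3, 4, 5`, each from left to right). -/

def H₁ : SimpleGraph (Fin 6) :=
  SimpleGraph.fromEdgeSet {s(0, 3), s(0, 4), s(1, 4), s(1, 5), s(2, 5)}

def H₂ : SimpleGraph (Fin 6) :=
  SimpleGraph.fromEdgeSet {s(0, 3), s(0, 4), s(0, 5), s(1, 3), s(2, 3)}

def H₃ : SimpleGraph (Fin 6) :=
  SimpleGraph.fromEdgeSet {s(0, 3), s(0, 4), s(1, 3), s(1, 4), s(1, 5), s(2, 5)}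

def H₄ : SimpleGraph (Fin 6) :=
  SimpleGraph.fromEdgeSet {s(0, 3), s(0, 4), s(1, 3), s(1, 4), s(1, 5), s(2, 4)}

def H₅ : SimpleGraph (Fin 6) :=
  SimpleGraph.fromEdgeSet {s(0, 4), s(0, 5), s(1, 3), s(1, 5), s(2, 3), s(2, 4)}

def H₆ : SimpleGraph (Fin 6) :=
  SimpleGraph.fromEdgeSet
    {s(0, 3), s(0, 4), s(1, 3), s(1, 4), s(2, 3), s(2, 4), s(2, 5)}

def H₇ : SimpleGraph (Fin 6) :=
  SimpleGraph.fromEdgeSet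
    {s(0, 3), s(0, 4), s(1, 3), s(1, 4), s(1, 5), s(2, 4), s(2, 5)}

def H₈ : SimpleGraph (Fin 6) :=
  SimpleGraph.fromEdgeSet
    {s(0, 3), s(0, 4), s(0, 5), s(1, 3), s(1, 4), s(1, 5), s(2, 3), s(2, 4)}

end SignlessLaplacian

/-! By Courant–Fischer, `q₂` is at most `c` once the quadratic form is at most `c|x|²` on some
hyperplane, and at least `c` once it is at least `c|x|²` on some plane. Let the colour classes have
sizes a ≤ b, with a + b = n. The form of G is that of K_{a,b} minus the squares of the missing
edges, and on the hyperplane where the values on the smaller class sum to 0 this gives q₂(G) ≤ b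
(`q₂_bip_le`). On the hyperplane of total sum 0 the complement has form (n-2)|x|² minus that of G,
so its `q₂` is at most n-2 (`q₂_compl_le`), strictly if a ≠ b (`q₂_compl_bip_lt`).

If a ≥ 3, then b ≤ n-3 gives the bound, and equality forces a = b = 3. If a = 1, then q₂(G) ≤ 1. If
a = 2, these estimates only give 2n-4; hyperplanes adapted to the few missing edges gain the rest
(`q₂_add_q₂_compl_bip_fin_two_lt`).

If a = b = 3, the complement has `q₂` equal to 4, so equality means q₂(G) = 3. For connected G this
amounts to a balanced vector (`HasBalancedVector`). An enumeration puts the connected graphs into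
ten classes; nine have such a vector, and one, a spider, has none. -/

open Matrix

/-! ### Variational bounds for the second eigenvalue. -/

section Spectral

variable {V : Type*} [Fintype V] [DecidableEq V] {M : Matrix V V ℝ}

/-- The quadratic form of a Hermitian matrix in an orthonormal eigenbasis listed in the order of
`eigenvalues₀`. -/
theorem Matrix.IsHermitian.exists_sorted_eigenbasis (hM : M.IsHermitian) :
    ∃ b : Fin (Fintype.card V) → V → ℝ,
      (∀ i j, b i ⬝ᵥ b j = if i = j then 1 else 0) ∧
      (∀ i, M *ᵥ b i = hM.eigenvalues₀ i • b i) ∧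
      (∀ x : V → ℝ, x ⬝ᵥ x = ∑ i, (b i ⬝ᵥ x) ^ 2) ∧
      (∀ x : V → ℝ, x ⬝ᵥ M *ᵥ x = ∑ i, hM.eigenvalues₀ i * (b i ⬝ᵥ x) ^ 2) := by
  let e : Fin (Fintype.card V) ≃ V := Fintype.equivOfCardEq (Fintype.card_fin _)
  let b : Fin (Fintype.card V) → V → ℝ := fun i => hM.eigenvectorBasis (e i)
  have hMb : ∀ i, M *ᵥ b i = hM.eigenvalues₀ i • b i := by
    intro i
    have := hM.mulVec_eigenvectorBasis (e i)
    rw [Matrix.IsHermitian.eigenvalues] at this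
    rw [Equiv.symm_apply_apply] at this
    exact this
  have hpars : ∀ x y : V → ℝ, x ⬝ᵥ y = ∑ i, (b i ⬝ᵥ x) * (b i ⬝ᵥ y) := by
    intro x y
    have h := hM.eigenvectorBasis.sum_inner_mul_inner (WithLp.toLp 2 x) (WithLp.toLp 2 y)
    simp only [EuclideanSpace.inner_eq_star_dotProduct, star_trivial] at h
    rw [dotProduct_comm, ← h, ← e.sum_comp]
    refine Finset.sum_congr rfl fun i _ => ?_
    rw [dotProduct_comm y]
  refine ⟨b, ?_, hMb, ?_, ?_⟩
  · intro i j
    have h := orthonormal_iff_ite.mp hM.eigenvectorBasis.orthonormal (e j) (e i)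
    simp only [EuclideanSpace.inner_eq_star_dotProduct, star_trivial, e.apply_eq_iff_eq] at h
    simpa only [eq_comm] using! h
  · intro x
    simp only [hpars x x, sq]
  · intro x
    rw [hpars]
    refine Finset.sum_congr rfl fun i _ => ?_
    have ht : Mᵀ = M := by simpa using hM.eq
    have : b i ⬝ᵥ M *ᵥ x = hM.eigenvalues₀ i * (b i ⬝ᵥ x) := by
      rw [dotProduct_mulVec, ← mulVec_transpose, ht, hMb, smul_dotProduct, smul_eq_mul]
    rw [this]
    ring

variable (hM : M.IsHermitian) (h : 1 < Fintype.card V)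

/-- The plane spanned by the first two eigenvectors meets every hyperplane, and on it the form is at
least the second eigenvalue. -/
theorem Matrix.IsHermitian.exists_second_eigenvalue_le (y : V → ℝ) :
    ∃ x : V → ℝ, x ≠ 0 ∧ y ⬝ᵥ x = 0 ∧
      hM.eigenvalues₀ ⟨1, h⟩ * (x ⬝ᵥ x) ≤ x ⬝ᵥ M *ᵥ x := by
  obtain ⟨b, horth, hMb, -, -⟩ := hM.exists_sorted_eigenbasis
  set i₀ : Fin (Fintype.card V) := ⟨0, by omega⟩
  set i₁ : Fin (Fintype.card V) := ⟨1, h⟩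
  have hne : i₀ ≠ i₁ := by simp [i₀, i₁]
  have hle : hM.eigenvalues₀ i₁ ≤ hM.eigenvalues₀ i₀ :=
    hM.eigenvalues₀_antitone (by simp [i₀, i₁])
  have key : ∀ s t : ℝ, (s ≠ 0 ∨ t ≠ 0) → s * (y ⬝ᵥ b i₀) + t * (y ⬝ᵥ b i₁) = 0 →
      ∃ x : V → ℝ, x ≠ 0 ∧ y ⬝ᵥ x = 0 ∧
        hM.eigenvalues₀ i₁ * (x ⬝ᵥ x) ≤ x ⬝ᵥ M *ᵥ x := by
    intro s t hst h0
    have hxx : (s • b i₀ + t • b i₁) ⬝ᵥ (s • b i₀ + t • b i₁) = s ^ 2 + t ^ 2 := by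
      simp [horth, hne, hne.symm]
      ring
    refine ⟨s • b i₀ + t • b i₁, ?_, ?_, ?_⟩
    · intro hz
      rw [hz, zero_dotProduct] at hxx
      rcases hst with hs | ht
      · nlinarith [sq_nonneg t, sq_pos_of_ne_zero hs]
      · nlinarith [sq_nonneg s, sq_pos_of_ne_zero ht]
    · simpa using h0
    · rw [hxx, mulVec_add, mulVec_smul, mulVec_smul, hMb, hMb]
      simp [horth, hne, hne.symm]
      nlinarith [mul_le_mul_of_nonneg_right hle (sq_nonneg s)]
  by_cases hz : y ⬝ᵥ b i₁ = 0
  · exact key 0 1 (by simp) (by simp [hz])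
  · exact key (y ⬝ᵥ b i₁) (-(y ⬝ᵥ b i₀)) (Or.inl hz) (by ring)

/-- The normal `y` is the leading eigenvector: its orthogonal complement involves only the later
eigenvalues. -/
theorem Matrix.IsHermitian.exists_le_second_eigenvalue :
    ∃ y : V → ℝ, ∀ x : V → ℝ, y ⬝ᵥ x = 0 →
      x ⬝ᵥ M *ᵥ x ≤ hM.eigenvalues₀ ⟨1, h⟩ * (x ⬝ᵥ x) := by
  obtain ⟨b, -, -, hxx, hMx⟩ := hM.exists_sorted_eigenbasis
  refine ⟨b ⟨0, by omega⟩, fun x hx => ?_⟩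
  rw [hxx, hMx, Finset.mul_sum]
  refine Finset.sum_le_sum fun i _ => ?_
  by_cases hi : i = ⟨0, by omega⟩
  · rw [hi, hx]
    simp
  · have hi' : (⟨1, h⟩ : Fin (Fintype.card V)) ≤ i := by
      have : (i : ℕ) ≠ 0 := fun h0 => hi (Fin.ext h0)
      rw [Fin.le_def]
      simp only
      omega
    exact mul_le_mul_of_nonneg_right (hM.eigenvalues₀_antitone hi') (sq_nonneg _)

end Spectral

namespace SignlessLaplacian

/-! ### The quadratic form of Q(G), and tests for bounding `q₂`. -/

section QuadraticForm

variable {V : Type*} [Fintype V] [DecidableEq V] (G : SimpleGraph V) [DecidableRel G.Adj]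

/-- The quadratic form of the signless Laplacian, summed over ordered pairs of vertices. -/
theorem two_mul_signlessLap_form (x : V → ℝ) :
    2 * (x ⬝ᵥ signlessLapMatrix G *ᵥ x) =
      ∑ v, ∑ w, if G.Adj v w then (x v + x w) ^ 2 else 0 := by
  have h1 : ∀ v, (signlessLapMatrix G *ᵥ x) v = ∑ w, if G.Adj v w then x v + x w else 0 := by
    intro v
    rw [signlessLapMatrix, add_mulVec, Pi.add_apply, SimpleGraph.degMatrix_mulVec_apply,
      SimpleGraph.adjMatrix_mulVec_apply, ← SimpleGraph.card_neighborFinset_eq_degree,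
      Finset.card_eq_sum_ones, Nat.cast_sum, Finset.sum_mul, ← Finset.sum_add_distrib,
      ← Finset.sum_filter]
    refine Finset.sum_congr (by ext; simp) fun w _ => by simp
  have h2 : x ⬝ᵥ signlessLapMatrix G *ᵥ x =
      ∑ v, ∑ w, if G.Adj v w then x v * (x v + x w) else 0 := by
    simp only [dotProduct, h1, Finset.mul_sum, mul_ite, mul_zero]
  have h3 : x ⬝ᵥ signlessLapMatrix G *ᵥ x =
      ∑ v, ∑ w, if G.Adj v w then x w * (x v + x w) else 0 := by
    rw [h2, Finset.sum_comm]
    refine Finset.sum_congr rfl fun v _ => Finset.sum_congr rfl fun w _ => ?_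
    simp only [G.adj_comm v w, add_comm]
  rw [two_mul]
  nth_rw 1 [h2]
  rw [h3, ← Finset.sum_add_distrib]
  refine Finset.sum_congr rfl fun v _ => ?_
  rw [← Finset.sum_add_distrib]
  refine Finset.sum_congr rfl fun w _ => ?_
  split_ifs <;> ring

/-- The signless Laplacian forms of a graph and of its complement add up to that of `K_n`. -/
theorem signlessLap_form_compl (x : V → ℝ) :
    x ⬝ᵥ signlessLapMatrix Gᶜ *ᵥ x =
      ((Fintype.card V : ℝ) - 2) * (x ⬝ᵥ x) + (∑ v, x v) ^ 2
        - x ⬝ᵥ signlessLapMatrix G *ᵥ x := by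
  have h := two_mul_signlessLap_form G x
  have hc := two_mul_signlessLap_form Gᶜ x
  -- Each ordered pair of distinct vertices is an edge of exactly one of the two graphs; the
  -- diagonal terms `(2 x v)²` are taken out.
  have hsum : (∑ v, ∑ w, if G.Adj v w then (x v + x w) ^ 2 else 0) +
      (∑ v, ∑ w, if Gᶜ.Adj v w then (x v + x w) ^ 2 else 0) =
      ∑ v, ∑ w, ((x v + x w) ^ 2 - if v = w then 4 * x v ^ 2 else 0) := by
    rw [← Finset.sum_add_distrib]
    refine Finset.sum_congr rfl fun v _ => ?_
    rw [← Finset.sum_add_distrib]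
    refine Finset.sum_congr rfl fun w _ => ?_
    by_cases hvw : v = w
    · subst hvw
      simp
      ring
    · by_cases ha : G.Adj v w <;> simp [hvw, ha]
  have hall : (∑ v, ∑ w, ((x v + x w) ^ 2 - if v = w then 4 * x v ^ 2 else 0)) =
      2 * (Fintype.card V : ℝ) * (x ⬝ᵥ x) + 2 * (∑ v, x v) ^ 2 - 4 * (x ⬝ᵥ x) := by
    have e1 : ∀ v, ∑ w, ((x v + x w) ^ 2 - if v = w then 4 * x v ^ 2 else 0) =
        (Fintype.card V : ℝ) * (x v * x v) + 2 * (x v * ∑ w, x w) + (x ⬝ᵥ x)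
          - 4 * (x v * x v) := by
      intro v
      rw [Finset.sum_sub_distrib, Finset.sum_ite_eq]
      simp only [add_sq, Finset.sum_add_distrib, Finset.sum_const, Finset.card_univ,
        Finset.mem_univ, if_true, nsmul_eq_mul, dotProduct, Finset.mul_sum]
      simp only [sq, mul_assoc]
    simp only [e1, Finset.sum_sub_distrib, Finset.sum_add_distrib, Finset.sum_const,
      Finset.card_univ, nsmul_eq_mul, ← Finset.mul_sum, ← Finset.sum_mul]
    rw [← dotProduct]
    ring
  linarith

variable (h : 1 < Fintype.card V)

theorem q₂_le_of_forall {c : ℝ} (y : V → ℝ)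
    (hy : ∀ x : V → ℝ, y ⬝ᵥ x = 0 → x ⬝ᵥ signlessLapMatrix G *ᵥ x ≤ c * (x ⬝ᵥ x)) :
    q₂ G h ≤ c := by
  obtain ⟨x, hx0, hyx, hx⟩ :=
    (isHermitian_signlessLapMatrix G).exists_second_eigenvalue_le h y
  have hpos : 0 < x ⬝ᵥ x :=
    lt_of_le_of_ne (Finset.sum_nonneg fun i _ => mul_self_nonneg (x i))
      (Ne.symm (by simpa [dotProduct_self_eq_zero]))
  exact le_of_mul_le_mul_right (hx.trans (hy x hyx)) hpos

theorem le_q₂_of_forall {c : ℝ} (p r : V → ℝ)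
    (hind : ∀ s t : ℝ, s • p + t • r = 0 → s = 0 ∧ t = 0)
    (hc : ∀ s t : ℝ, c * ((s • p + t • r) ⬝ᵥ (s • p + t • r)) ≤
      (s • p + t • r) ⬝ᵥ signlessLapMatrix G *ᵥ (s • p + t • r)) :
    c ≤ q₂ G h := by
  obtain ⟨y, hy⟩ := (isHermitian_signlessLapMatrix G).exists_le_second_eigenvalue h
  have key : ∀ s t : ℝ, (s ≠ 0 ∨ t ≠ 0) → s * (y ⬝ᵥ p) + t * (y ⬝ᵥ r) = 0 → c ≤ q₂ G h := by
    intro s t hst h0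
    have hle := (hc s t).trans (hy _ (by simpa using h0))
    have hpos : 0 < (s • p + t • r) ⬝ᵥ (s • p + t • r) := by
      refine lt_of_le_of_ne (Finset.sum_nonneg fun i _ => mul_self_nonneg _) (Ne.symm ?_)
      rw [Ne, dotProduct_self_eq_zero]
      intro hz
      obtain ⟨hs, ht⟩ := hind s t hz
      simp [hs, ht] at hst
    exact le_of_mul_le_mul_right hle hpos
  by_cases hz : y ⬝ᵥ r = 0
  · exact key 0 1 (by simp) (by simp [hz])
  · exact key (y ⬝ᵥ r) (-(y ⬝ᵥ p)) (Or.inl hz) (by ring)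

variable {G} in
theorem q₂_le_q₂_of_iso {W : Type*} [Fintype W] [DecidableEq W] {H : SimpleGraph W}
    [DecidableRel H.Adj] (e : G ≃g H) (hW : 1 < Fintype.card W) : q₂ G h ≤ q₂ H hW := by
  obtain ⟨y, hy⟩ := (isHermitian_signlessLapMatrix H).exists_le_second_eigenvalue hW
  refine q₂_le_of_forall G h (fun v => y (e v)) fun x hx => ?_
  have hdot : ∀ u w : V → ℝ, (fun z => u (e.symm z)) ⬝ᵥ (fun z => w (e.symm z)) = u ⬝ᵥ w :=
    fun u w => e.symm.toEquiv.sum_comp fun v => u v * w v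
  have h1 := hy (fun z => x (e.symm z)) (by
    rw [← hx, ← hdot]
    simp)
  have h2 : (fun z => x (e.symm z)) ⬝ᵥ signlessLapMatrix H *ᵥ (fun z => x (e.symm z)) =
      x ⬝ᵥ signlessLapMatrix G *ᵥ x := by
    have h3 := two_mul_signlessLap_form H (fun z => x (e.symm z))
    have h4 := two_mul_signlessLap_form G x
    rw [← e.toEquiv.sum_comp] at h3
    have h5 : ∀ v, (∑ w, if H.Adj (e.toEquiv v) w then
        (x (e.symm (e.toEquiv v)) + x (e.symm w)) ^ 2 else 0) =
        ∑ w, if G.Adj v w then (x v + x w) ^ 2 else 0 := by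
      intro v
      rw [← e.toEquiv.sum_comp]
      refine Finset.sum_congr rfl fun w _ => ?_
      have := e.map_adj_iff (v := v) (w := w)
      simp [this]
    rw [Finset.sum_congr rfl fun v _ => h5 v] at h3
    linarith
  rw [h2, hdot] at h1
  exact h1

variable {G} in
theorem q₂_congr {W : Type*} [Fintype W] [DecidableEq W] {H : SimpleGraph W}
    [DecidableRel H.Adj] (e : G ≃g H) (hW : 1 < Fintype.card W) : q₂ G h = q₂ H hW :=
  le_antisymm (q₂_le_q₂_of_iso h e hW) (q₂_le_q₂_of_iso hW e.symm h)

end QuadraticForm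

/-- Isomorphic graphs have isomorphic complements. -/
def complIso {V W : Type*} {G : SimpleGraph V} {H : SimpleGraph W} (e : G ≃g H) : Gᶜ ≃g Hᶜ :=
  ⟨e.toEquiv, by
    intro a b
    simp [SimpleGraph.compl_adj, e.map_adj_iff]⟩

/-! ### Bipartite graphs as biadjacency matrices: bounds for any class sizes. -/

section Bip

variable {α β : Type*}

/-- The bipartite graph on `α ⊕ β` with biadjacency matrix `M`. -/
def bip (M : α → β → Bool) : SimpleGraph (α ⊕ β) where
  Adj
    | .inl i, .inr j => M i j = true
    | .inr j, .inl i => M i j = true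
    | .inl _, .inl _ => False
    | .inr _, .inr _ => False
  symm := ⟨by rintro (i | i) (j | j) h <;> exact h⟩
  loopless := ⟨by rintro (i | i) h <;> exact h⟩

variable (M : α → β → Bool)

@[simp] theorem bip_adj_inl_inr (i : α) (j : β) :
    (bip M).Adj (.inl i) (.inr j) ↔ M i j = true := Iff.rfl

@[simp] theorem bip_adj_inr_inl (i : α) (j : β) :
    (bip M).Adj (.inr j) (.inl i) ↔ M i j = true := Iff.rfl

@[simp] theorem bip_not_adj_inl_inl (i j : α) : ¬(bip M).Adj (.inl i) (.inl j) := id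

@[simp] theorem bip_not_adj_inr_inr (i j : β) : ¬(bip M).Adj (.inr i) (.inr j) := id

instance : DecidableRel (bip M).Adj
  | .inl i, .inr j => inferInstanceAs (Decidable (M i j = true))
  | .inr j, .inl i => inferInstanceAs (Decidable (M i j = true))
  | .inl _, .inl _ => inferInstanceAs (Decidable False)
  | .inr _, .inr _ => inferInstanceAs (Decidable False)

/-- Relabelling the rows and columns of the biadjacency matrix. -/
def bipCongr {α' β' : Type*} (σ : α' ≃ α) (τ : β' ≃ β) :
    bip (fun i j => M (σ i) (τ j)) ≃g bip M where
  toEquiv := Equiv.sumCongr σ τ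
  map_rel_iff' := by rintro (i | i) (j | j) <;> simp

/-- Transposing the biadjacency matrix. -/
def bipSwap : bip (fun j i => M i j) ≃g bip M where
  toEquiv := Equiv.sumComm β α
  map_rel_iff' := by rintro (i | i) (j | j) <;> simp

variable {M} in
theorem bip_connected_induction (hc : (bip M).Connected) {P : α ⊕ β → Prop} {v₀ : α ⊕ β}
    (h₀ : P v₀) (hstep : ∀ i j, M i j = true → (P (.inl i) ↔ P (.inr j))) (v : α ⊕ β) : P v := by
  obtain ⟨w⟩ := hc.preconnected v₀ v
  induction w with
  | nil => exact h₀
  | @cons a b c hab _ ih =>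
    refine ih ?_
    rcases a with i | i <;> rcases b with j | j
    · exact absurd hab (bip_not_adj_inl_inl M i j)
    · exact (hstep i j hab).1 h₀
    · exact (hstep j i hab).2 h₀
    · exact absurd hab (bip_not_adj_inr_inr M i j)

variable [Fintype α] [Fintype β]

theorem dotProduct_self_sum (z : α ⊕ β → ℝ) :
    z ⬝ᵥ z = ∑ i, z (.inl i) ^ 2 + ∑ j, z (.inr j) ^ 2 := by
  simp [dotProduct, Fintype.sum_sum_type, sq]

theorem sum_missing_nonneg (z : α ⊕ β → ℝ) :
    0 ≤ ∑ i, ∑ j, if M i j then 0 else (z (.inl i) + z (.inr j)) ^ 2 :=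
  Finset.sum_nonneg fun i _ => Finset.sum_nonneg fun j _ => by split_ifs <;> positivity

variable [DecidableEq α] [DecidableEq β]

theorem bip_form (z : α ⊕ β → ℝ) :
    z ⬝ᵥ signlessLapMatrix (bip M) *ᵥ z =
      ∑ i, ∑ j, if M i j then (z (.inl i) + z (.inr j)) ^ 2 else 0 := by
  have h := two_mul_signlessLap_form (bip M) z
  simp only [Fintype.sum_sum_type, bip_adj_inl_inr, bip_adj_inr_inl, bip_not_adj_inl_inl,
    bip_not_adj_inr_inr, if_false, Finset.sum_const_zero, zero_add, add_zero] at h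
  have h2 : (∑ j, ∑ i, if M i j = true then (z (.inr j) + z (.inl i)) ^ 2 else 0) =
      ∑ i, ∑ j, if M i j then (z (.inl i) + z (.inr j)) ^ 2 else 0 := by
    rw [Finset.sum_comm]
    simp only [add_comm]
  linarith

/-- The form of `bip M` is that of the complete bipartite graph minus the missing edges. -/
theorem bip_form_eq_sub (z : α ⊕ β → ℝ) :
    z ⬝ᵥ signlessLapMatrix (bip M) *ᵥ z =
      Fintype.card β * ∑ i, z (.inl i) ^ 2 + Fintype.card α * ∑ j, z (.inr j) ^ 2
        + 2 * (∑ i, z (.inl i)) * (∑ j, z (.inr j))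
        - ∑ i, ∑ j, if M i j then 0 else (z (.inl i) + z (.inr j)) ^ 2 := by
  have h : (∑ i, ∑ j, if M i j then (z (.inl i) + z (.inr j)) ^ 2 else 0) =
      ∑ i, ∑ j, ((z (.inl i) + z (.inr j)) ^ 2 -
        if M i j then 0 else (z (.inl i) + z (.inr j)) ^ 2) := by
    refine Finset.sum_congr rfl fun i _ => Finset.sum_congr rfl fun j _ => ?_
    split_ifs <;> simp
  rw [bip_form, h]
  simp only [Finset.sum_sub_distrib, add_sq, Finset.sum_add_distrib, Finset.sum_const,
    Finset.card_univ, nsmul_eq_mul, ← Finset.mul_sum, ← Finset.sum_mul]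
  ring

variable (h : 1 < Fintype.card (α ⊕ β))

/-- When the values on `α` sum to 0, the cross term of the form of K_{a,b} vanishes and only the
weights b and a on the two classes remain. -/
theorem q₂_bip_le (hab : Fintype.card α ≤ Fintype.card β) :
    q₂ (bip M) h ≤ Fintype.card β := by
  refine q₂_le_of_forall _ h (Sum.elim 1 0) fun z hz => ?_
  have hz' : ∑ i, z (.inl i) = 0 := by
    simpa [dotProduct, Fintype.sum_sum_type] using hz
  rw [bip_form_eq_sub, hz', dotProduct_self_sum]
  have h1 := sum_missing_nonneg M z
  have h2 : (Fintype.card α : ℝ) * ∑ j, z (.inr j) ^ 2 ≤ Fintype.card β * ∑ j, z (.inr j) ^ 2 := by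
    gcongr
  linarith

/-- With a single row, the same hyperplane makes the value there 0. -/
theorem q₂_bip_le_one (hα : Fintype.card α = 1) : q₂ (bip M) h ≤ 1 := by
  refine q₂_le_of_forall _ h (Sum.elim 1 0) fun z hz => ?_
  have hz' : ∑ i, z (.inl i) = 0 := by
    simpa [dotProduct, Fintype.sum_sum_type] using hz
  obtain ⟨a, ha⟩ := Fintype.card_eq_one_iff.1 hα
  have huniv : (Finset.univ : Finset α) = {a} := by ext i; simp [ha i]
  have hza : z (.inl a) = 0 := by simpa [huniv] using hz'
  have h1 := sum_missing_nonneg M z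
  rw [bip_form_eq_sub, hz', dotProduct_self_sum, hα]
  simp only [huniv, Finset.sum_singleton, hza] at h1 ⊢
  push_cast
  linarith

theorem q₂_compl_le {V : Type*} [Fintype V] [DecidableEq V] (G : SimpleGraph V)
    [DecidableRel G.Adj] (hV : 1 < Fintype.card V) : q₂ Gᶜ hV ≤ Fintype.card V - 2 := by
  refine q₂_le_of_forall _ hV 1 fun z hz => ?_
  have hz' : ∑ v, z v = 0 := by simpa [dotProduct] using hz
  rw [signlessLap_form_compl, hz']
  have h1 := two_mul_signlessLap_form G z
  have h2 : 0 ≤ ∑ v, ∑ w, if G.Adj v w then (z v + z w) ^ 2 else 0 :=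
    Finset.sum_nonneg fun i _ => Finset.sum_nonneg fun j _ => by split_ifs <;> positivity
  linarith

/-- Equality would give a nonzero `z` of sum 0 on which the form of G vanishes, so that `z` changes
sign along every edge. By connectedness `z` is c on `α` and -c on `β`, and sum 0 with unequal
classes gives c = 0. -/
theorem q₂_compl_bip_lt (hc : (bip M).Connected) (hab : Fintype.card α ≠ Fintype.card β) :
    q₂ (bip M)ᶜ h < Fintype.card (α ⊕ β) - 2 := by
  refine lt_of_le_of_ne (q₂_compl_le _ h) fun heq => ?_
  obtain ⟨z, hz0, hz1, hz⟩ :=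
    (isHermitian_signlessLapMatrix (bip M)ᶜ).exists_second_eigenvalue_le h 1
  have hz' : ∑ v, z v = 0 := by simpa [dotProduct] using hz1
  change q₂ (bip M)ᶜ h * _ ≤ _ at hz
  rw [heq, signlessLap_form_compl, hz', bip_form] at hz
  have hnn : ∀ i j, 0 ≤ if M i j then (z (.inl i) + z (.inr j)) ^ 2 else 0 := fun i j => by
    split_ifs <;> positivity
  have hs : ∑ i, ∑ j, (if M i j then (z (.inl i) + z (.inr j)) ^ 2 else 0) = 0 :=
    le_antisymm (by linarith) (Finset.sum_nonneg fun i _ => Finset.sum_nonneg fun j _ => hnn i j)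
  have hadj : ∀ i j, M i j = true → z (.inl i) + z (.inr j) = 0 := by
    intro i j hij
    rw [Finset.sum_eq_zero_iff_of_nonneg
      fun i _ => Finset.sum_nonneg fun j _ => hnn i j] at hs
    have h1 := hs i (Finset.mem_univ i)
    rw [Finset.sum_eq_zero_iff_of_nonneg fun j _ => hnn i j] at h1
    have h2 := h1 j (Finset.mem_univ j)
    rw [if_pos hij] at h2
    exact pow_eq_zero_iff two_ne_zero |>.1 h2
  obtain ⟨v₀⟩ := hc.nonempty
  set s : α ⊕ β → ℝ := Sum.elim (fun i => z (.inl i)) (fun j => -z (.inr j)) with hsdef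
  have hconst : ∀ v, s v = s v₀ := bip_connected_induction hc rfl fun i j hij => by
    have := hadj i j hij
    have h1 : s (.inl i) = s (.inr j) := by simp only [hsdef, Sum.elim_inl, Sum.elim_inr]; linarith
    rw [h1]
  have hl : ∀ i, z (.inl i) = s v₀ := fun i => hconst (.inl i)
  have hr : ∀ j, z (.inr j) = -s v₀ := fun j => by
    rw [← hconst (.inr j)]
    simp [hsdef]
  simp only [Fintype.sum_sum_type, hl, hr, Finset.sum_const, Finset.card_univ, nsmul_eq_mul] at hz'
  have hne : (Fintype.card α : ℝ) - Fintype.card β ≠ 0 :=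
    sub_ne_zero.2 (by exact_mod_cast hab)
  have ht : s v₀ = 0 := by
    have : ((Fintype.card α : ℝ) - Fintype.card β) * s v₀ = 0 := by linarith
    exact (mul_eq_zero.1 this).resolve_left hne
  refine hz0 (funext ?_)
  rintro (i | j)
  · simp [hl, ht]
  · simp [hr, ht]

/-- On the plane of vectors s+t on `α`, s-t on `β`, each edge of G contributes 4s². There are at
most b² edges, so the square of the total sum, 4b²s², outweighs them. -/
theorem le_q₂_compl_bip (hab : Fintype.card α = Fintype.card β) :
    (Fintype.card (α ⊕ β) : ℝ) - 2 ≤ q₂ (bip M)ᶜ h := by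
  have hα : 0 < Fintype.card α := by
    rw [Fintype.card_sum] at h
    omega
  obtain ⟨a⟩ := Fintype.card_pos_iff.1 hα
  obtain ⟨b⟩ := Fintype.card_pos_iff.1 (hab ▸ hα)
  refine le_q₂_of_forall _ h 1 (Sum.elim 1 (-1)) (fun s t hst => ?_) fun s t => ?_
  · have h1 := congrFun hst (.inl a)
    have h2 := congrFun hst (.inr b)
    simp at h1 h2
    exact ⟨by linarith, by linarith⟩
  · rw [signlessLap_form_compl, bip_form_eq_sub]
    have hm := sum_missing_nonneg M
      (s • (1 : α ⊕ β → ℝ) + t • (Sum.elim 1 (-1) : α ⊕ β → ℝ))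
    have hS : ∑ v, (s • (1 : α ⊕ β → ℝ) + t • (Sum.elim 1 (-1) : α ⊕ β → ℝ)) v =
        2 * Fintype.card β * s := by
      simp [Fintype.sum_sum_type, hab]
      ring
    rw [hS]
    simp only [Pi.add_apply, Pi.smul_apply, Pi.one_apply, Sum.elim_inl, Sum.elim_inr,
      Finset.sum_const, Finset.card_univ, nsmul_eq_mul, hab, smul_eq_mul, Pi.neg_apply] at hm ⊢
    nlinarith

end Bip

/-! ### Spanning subgraphs of K_{2,b}: bounds for the graph itself. -/

section TwoRows

variable {β : Type*} [Fintype β] [DecidableEq β] (M : Fin 2 → β → Bool)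
  (h : 1 < Fintype.card (Fin 2 ⊕ β))

theorem bip_fin_two_form (z : Fin 2 ⊕ β → ℝ) :
    z ⬝ᵥ signlessLapMatrix (bip M) *ᵥ z =
      ∑ j, ((if M 0 j then (z (.inl 0) + z (.inr j)) ^ 2 else 0) +
        if M 1 j then (z (.inl 1) + z (.inr j)) ^ 2 else 0) := by
  rw [bip_form, Fin.sum_univ_two, Finset.sum_add_distrib]

/-- Bounding the form on a line of values at the two rows, one column at a time. -/
theorem q₂_bip_fin_two_le {l u v K : ℝ} (c : β → ℝ) (huv : u ≠ 0 ∨ v ≠ 0)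
    (hterm : ∀ s y : ℝ, ∀ j, (if M 0 j then (u * s + y) ^ 2 else 0) +
      (if M 1 j then (v * s + y) ^ 2 else 0) ≤ l * y ^ 2 + c j * s ^ 2)
    (hK : ∑ j, c j ≤ K) (hl : K ≤ l * (u ^ 2 + v ^ 2)) : q₂ (bip M) h ≤ l := by
  -- On this hyperplane the row values are `(u s, v s)`, while the column values are free and can be
  -- optimised separately.
  refine q₂_le_of_forall _ h (Sum.elim ![v, -u] 0) fun z hz => ?_
  have hz' : v * z (.inl 0) = u * z (.inl 1) := by
    simp [dotProduct, Fintype.sum_sum_type] at hz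
    linarith
  have huv' : 0 < u ^ 2 + v ^ 2 := by rcases huv with h | h <;> positivity
  obtain ⟨s, h0, h1⟩ : ∃ s, z (.inl 0) = u * s ∧ z (.inl 1) = v * s := by
    refine ⟨(u * z (.inl 0) + v * z (.inl 1)) / (u ^ 2 + v ^ 2), ?_, ?_⟩ <;> field_simp
    · linear_combination v * hz'
    · linear_combination -u * hz'
  rw [bip_fin_two_form, dotProduct_self_sum, Fin.sum_univ_two, h0, h1]
  calc _ ≤ ∑ j, (l * z (.inr j) ^ 2 + c j * s ^ 2) :=
        Finset.sum_le_sum fun j _ => hterm s (z (.inr j)) j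
    _ = l * ∑ j, z (.inr j) ^ 2 + (∑ j, c j) * s ^ 2 := by
        rw [Finset.sum_add_distrib, ← Finset.mul_sum, ← Finset.sum_mul]
    _ ≤ _ := by nlinarith [mul_le_mul_of_nonneg_right (hK.trans hl) (sq_nonneg s)]

/-- If one row misses at least two columns, `q₂ ≤ |β| - 1`. -/
theorem q₂_bip_le_of_two_missing (hb : 4 ≤ Fintype.card β)
    (hp : 2 ≤ (Finset.univ.filter fun j => M 1 j = false).card) :
    q₂ (bip M) h ≤ Fintype.card β - 1 := by
  have hb' : (4 : ℝ) ≤ Fintype.card β := by exact_mod_cast hb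
  have hp' : (2 : ℝ) ≤ (Finset.univ.filter fun j => M 1 j = false).card := by exact_mod_cast hp
  set b : ℝ := (Fintype.card β : ℝ)
  -- For a full column, `5 + K` is the exact maximum over `y` at `s = 1` of the column's form minus
  -- `(b - 1) y²`.
  set K : ℝ := 1 / (b - 3) with hKdef
  have hK : K * (b - 3) = 1 := one_div_mul_cancel (by linarith)
  have hK0 : 0 < K := by
    rw [hKdef]
    exact one_div_pos.2 (by linarith)
  have hK1 : K ≤ 1 := by nlinarith
  -- The larger weight sits on the row with missing edges. A column missing there costs at most `3 /
  -- 2` instead of `5 + K`, and two of them suffice because `K ≤ 1`; for b = 4 there is no slack.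
  refine q₂_bip_fin_two_le M h (u := -1) (v := 2) (K := 3 + (b - 2) * (5 + K))
    (fun j => 5 + K - if M 1 j = false then 7 / 2 + K else 0) (by simp) ?_ ?_ (by nlinarith)
  · intro s y j
    have e1 : (-1 * s + y) ^ 2 ≤ (b - 1) * y ^ 2 + 3 / 2 * s ^ 2 := by
      nlinarith [sq_nonneg (s + 2 * y), sq_nonneg y]
    have e2 : (-1 * s + y) ^ 2 + (2 * s + y) ^ 2 ≤ (b - 1) * y ^ 2 + (5 + K) * s ^ 2 := by
      have : K * ((-1 * s + y) ^ 2 + (2 * s + y) ^ 2 - ((b - 1) * y ^ 2 + (5 + K) * s ^ 2)) =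
          -(K * s - y) ^ 2 := by linear_combination (-y ^ 2) * hK
      nlinarith [sq_nonneg (K * s - y)]
    cases M 0 j <;> cases M 1 j <;> simp only [if_true, if_false, reduceCtorEq] <;>
      nlinarith [sq_nonneg (2 * s + y), sq_nonneg (-1 * s + y)]
  · rw [Finset.sum_sub_distrib, ← Finset.sum_filter, Finset.sum_const, Finset.sum_const,
      Finset.card_univ, nsmul_eq_mul, nsmul_eq_mul]
    change b * (5 + K) - _ ≤ _
    nlinarith

variable {M}

/-- The complement's form when both rows are full up to one missing column each. -/
theorem compl_form_of_full (h0 : ∀ j, M 0 j = true) (h1 : ∀ j, M 1 j = true)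
    (z : Fin 2 ⊕ β → ℝ) :
    z ⬝ᵥ signlessLapMatrix (bip M)ᶜ *ᵥ z =
      ((Fintype.card β : ℝ) - 2) * ∑ j, z (.inr j) ^ 2 + (z (.inl 0) + z (.inl 1)) ^ 2
        + (∑ j, z (.inr j)) ^ 2 := by
  rw [signlessLap_form_compl, bip_fin_two_form, dotProduct_self_sum, Fintype.sum_sum_type]
  simp only [Fin.sum_univ_two, h0, h1, if_true, add_sq, Finset.sum_add_distrib, Finset.sum_const,
    Finset.card_univ, nsmul_eq_mul, ← Finset.mul_sum, Fintype.card_sum, Fintype.card_fin]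
  push_cast
  ring

/-- The complement of K_{2,b} is K_2 ∪ K_b; an edge deleted from K_{2,b} joins the complement and
adds its own square. -/
theorem compl_form_of_one_missing {w : β} (h0 : ∀ j, M 0 j = true)
    (h1 : ∀ j, M 1 j = decide (j ≠ w)) (z : Fin 2 ⊕ β → ℝ) :
    z ⬝ᵥ signlessLapMatrix (bip M)ᶜ *ᵥ z =
      ((Fintype.card β : ℝ) - 2) * ∑ j, z (.inr j) ^ 2 + (z (.inl 0) + z (.inl 1)) ^ 2
        + (∑ j, z (.inr j)) ^ 2 + (z (.inl 1) + z (.inr w)) ^ 2 := by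
  have e : ∀ j, (if M 1 j then (z (.inl 1) + z (.inr j)) ^ 2 else 0) =
      (z (.inl 1) + z (.inr j)) ^ 2 - if j = w then (z (.inl 1) + z (.inr j)) ^ 2 else 0 := by
    intro j
    by_cases hj : j = w <;> simp [h1, hj]
  rw [signlessLap_form_compl, bip_fin_two_form, dotProduct_self_sum, Fintype.sum_sum_type]
  simp only [e, Finset.sum_add_distrib, Finset.sum_sub_distrib, Finset.sum_ite_eq',
    Finset.mem_univ, if_true, h0]
  simp only [Fin.sum_univ_two, add_sq, Finset.sum_add_distrib, Finset.sum_const,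
    Finset.card_univ, nsmul_eq_mul, ← Finset.mul_sum, Fintype.card_sum, Fintype.card_fin]
  push_cast
  ring

theorem compl_form_of_two_missing {r w : β} (h0 : ∀ j, M 0 j = decide (j ≠ r))
    (h1 : ∀ j, M 1 j = decide (j ≠ w)) (z : Fin 2 ⊕ β → ℝ) :
    z ⬝ᵥ signlessLapMatrix (bip M)ᶜ *ᵥ z =
      ((Fintype.card β : ℝ) - 2) * ∑ j, z (.inr j) ^ 2 + (z (.inl 0) + z (.inl 1)) ^ 2
        + (∑ j, z (.inr j)) ^ 2 + (z (.inl 0) + z (.inr r)) ^ 2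
        + (z (.inl 1) + z (.inr w)) ^ 2 := by
  have e : ∀ i x, (∀ j, M i j = decide (j ≠ x)) → ∀ j,
      (if M i j then (z (.inl i) + z (.inr j)) ^ 2 else 0) =
      (z (.inl i) + z (.inr j)) ^ 2 - if j = x then (z (.inl i) + z (.inr j)) ^ 2 else 0 := by
    intro i x hi j
    by_cases hj : j = x <;> simp [hi, hj]
  rw [signlessLap_form_compl, bip_fin_two_form, dotProduct_self_sum, Fintype.sum_sum_type]
  simp only [e 0 r h0, e 1 w h1, Finset.sum_add_distrib, Finset.sum_sub_distrib,
    Finset.sum_ite_eq', Finset.mem_univ, if_true]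
  simp only [Fin.sum_univ_two, add_sq, Finset.sum_add_distrib, Finset.sum_const,
    Finset.card_univ, nsmul_eq_mul, ← Finset.mul_sum, Fintype.card_sum, Fintype.card_fin]
  push_cast
  ring

theorem q₂_compl_le_of_full (h0 : ∀ j, M 0 j = true) (h1 : ∀ j, M 1 j = true)
    (hb : 4 ≤ Fintype.card β) : q₂ (bip M)ᶜ h ≤ Fintype.card β - 2 := by
  have hb' : (4 : ℝ) ≤ Fintype.card β := by exact_mod_cast hb
  refine q₂_le_of_forall _ h (Sum.elim 0 1) fun z hz => ?_
  have hz' : ∑ j, z (.inr j) = 0 := by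
    simpa [dotProduct, Fintype.sum_sum_type] using hz
  rw [compl_form_of_full h0 h1, hz', dotProduct_self_sum, Fin.sum_univ_two]
  nlinarith [sq_nonneg (z (.inl 0) - z (.inl 1)), sq_nonneg (z (.inl 0)), sq_nonneg (z (.inl 1))]

/-- The gain 41/100 is paired with the gain 3/5 of `q₂_compl_le_of_one_missing`: together they just
exceed 1. -/
theorem q₂_bip_le_of_one_missing {w : β} (h0 : ∀ j, M 0 j = true)
    (h1 : ∀ j, M 1 j = decide (j ≠ w)) (hb : 4 ≤ Fintype.card β) :
    q₂ (bip M) h ≤ Fintype.card β - 41 / 100 := by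
  have hb' : (4 : ℝ) ≤ Fintype.card β := by exact_mod_cast hb
  set b : ℝ := (Fintype.card β : ℝ) with hbdef
  set K : ℝ := 1 / (b - 241 / 100) with hKdef
  have hK : K * (b - 241 / 100) = 1 := one_div_mul_cancel (by linarith)
  have hK0 : 0 < K := by
    rw [hKdef]
    exact one_div_pos.2 (by linarith)
  have hK1 : K ≤ 63 / 100 := by nlinarith
  -- As before, `25 + K` is the optimum for a full column, and `25 / 2` bounds that of the column
  -- `w`, namely 9 + 9/(b - 1.41), for b ≥ 4.
  refine q₂_bip_fin_two_le M h (u := -3) (v := 4) (K := 25 / 2 + (b - 1) * (25 + K))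
    (fun j => 25 + K - if j = w then 25 / 2 + K else 0) (by simp) ?_ ?_ (by nlinarith)
  · intro s y j
    have e1 : (-3 * s + y) ^ 2 ≤ (b - 41 / 100) * y ^ 2 + 25 / 2 * s ^ 2 := by
      nlinarith [sq_nonneg (7 * s + 6 * y), sq_nonneg y]
    have e2 : (-3 * s + y) ^ 2 + (4 * s + y) ^ 2 ≤
        (b - 41 / 100) * y ^ 2 + (25 + K) * s ^ 2 := by
      have : K * ((-3 * s + y) ^ 2 + (4 * s + y) ^ 2 -
          ((b - 41 / 100) * y ^ 2 + (25 + K) * s ^ 2)) =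
          -(K * s - y) ^ 2 := by linear_combination (-y ^ 2) * hK
      nlinarith [sq_nonneg (K * s - y)]
    by_cases hj : j = w <;> simp [h0, h1, hj] at e1 e2 ⊢ <;> linarith
  · rw [Finset.sum_sub_distrib, Finset.sum_ite_eq', if_pos (Finset.mem_univ _), Finset.sum_const,
      Finset.card_univ, nsmul_eq_mul, ← hbdef]
    nlinarith

theorem q₂_bip_le_of_two_single_missing {r w : β} (hrw : r ≠ w)
    (h0 : ∀ j, M 0 j = decide (j ≠ r)) (h1 : ∀ j, M 1 j = decide (j ≠ w))
    (hb : 4 ≤ Fintype.card β) : q₂ (bip M) h ≤ Fintype.card β - 11 / 20 := by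
  have hb' : (4 : ℝ) ≤ Fintype.card β := by exact_mod_cast hb
  set b : ℝ := (Fintype.card β : ℝ) with hbdef
  -- Opposite row values cancel the cross terms of a full column, whose cost is 2; a column with one
  -- edge costs at most 1.41 = 2 - 0.59.
  refine q₂_bip_fin_two_le M h (u := 1) (v := -1) (K := 2 * b - 2 * (59 / 100))
    (fun j => 2 - (if j = r then 59 / 100 else 0) - if j = w then 59 / 100 else 0)
    (by simp) ?_ ?_ (by linarith)
  · intro s y j
    have e1 : (-1 * s + y) ^ 2 ≤ (b - 11 / 20) * y ^ 2 + 141 / 100 * s ^ 2 := by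
      nlinarith [sq_nonneg (41 * s + 100 * y), sq_nonneg y]
    have e2 : (1 * s + y) ^ 2 ≤ (b - 11 / 20) * y ^ 2 + 141 / 100 * s ^ 2 := by
      nlinarith [sq_nonneg (41 * s - 100 * y), sq_nonneg y]
    by_cases hj : j = w
    · simp [h0, h1, hj, hrw.symm] at e1 e2 ⊢
      linarith
    · by_cases hj' : j = r
      · simp [h0, h1, hj', hrw] at e1 e2 ⊢
        linarith
      · simp [h0, h1, hj', hj]
        nlinarith [sq_nonneg y]
  · rw [Finset.sum_sub_distrib, Finset.sum_sub_distrib, Finset.sum_ite_eq', Finset.sum_ite_eq',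
      if_pos (Finset.mem_univ _), if_pos (Finset.mem_univ _), Finset.sum_const,
      Finset.card_univ, nsmul_eq_mul, ← hbdef]
    linarith

end TwoRows

/-! ### Spanning subgraphs of K_{2,b}: bounds for the complement, and the case a = 2. -/

section TwoRowsComplement

theorem sq_sum_sub_le {β : Type*} [Fintype β] [DecidableEq β] (y : β → ℝ) (s : Finset β) :
    (∑ j, y j - ∑ j ∈ s, y j) ^ 2 ≤
      (Fintype.card β - s.card : ℝ) * (∑ j, y j ^ 2 - ∑ j ∈ s, y j ^ 2) := by
  have h := sq_sum_le_card_mul_sum_sq (s := sᶜ) (f := y)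
  have e1 := Finset.sum_compl_add_sum s y
  have e2 := Finset.sum_compl_add_sum s (fun j => y j ^ 2)
  have e3 : ((sᶜ.card : ℕ) : ℝ) = Fintype.card β - s.card := by
    rw [Finset.card_compl, Nat.cast_sub (Finset.card_le_univ s)]
  rw [← e1, ← e2, add_sub_cancel_right, add_sub_cancel_right, ← e3]
  exact h

variable {β : Type*} [Fintype β] [DecidableEq β] {M : Fin 2 → β → Bool}
  (h : 1 < Fintype.card (Fin 2 ⊕ β))

/-- Here `u`, `v` are the row values, `x` the value at the missed column, `S` and `Y` the sum and
square sum over all columns. `hY` is Cauchy–Schwarz on the other columns. -/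
theorem one_missing_inequality {n : ℕ} (hn : 4 ≤ n) {u v x S Y : ℝ} (hS : S = -v / 2)
    (hY : (S - x) ^ 2 ≤ (n - 1 : ℝ) * (Y - x ^ 2)) (hY0 : x ^ 2 ≤ Y) :
    (n - 2 : ℝ) * Y + (u + v) ^ 2 + S ^ 2 + (v + x) ^ 2 ≤
      (n - 3 / 5 : ℝ) * (u ^ 2 + v ^ 2 + Y) := by
  subst hS
  obtain rfl | rfl | hn6 : n = 4 ∨ n = 5 ∨ 6 ≤ n := by omega
  · norm_num at hY ⊢
    nlinarith [sq_nonneg (12 * u - 5 * v), sq_nonneg (26 * x - 23 * v)]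
  · norm_num at hY ⊢
    nlinarith [sq_nonneg (17 * u - 5 * v), sq_nonneg (10 * x - 11 * v)]
  -- From n = 6 on, `Y ≥ x²` is enough; only n = 4 and n = 5 need Cauchy–Schwarz. The squares
  -- supplied complete the square in `u` and `x`.
  · have hn6' : (6 : ℝ) ≤ n := by exact_mod_cast hn6
    nlinarith [sq_nonneg (22 * u - 5 * v), sq_nonneg (2 * x - 5 * v),
      mul_le_mul_of_nonneg_right hn6' (sq_nonneg u), mul_le_mul_of_nonneg_right hn6' (sq_nonneg v)]

/-- Exchanging the two rows together with their missed columns is a symmetry. In sums and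
differences the inequality splits into an antisymmetric part in `d`, `D` and a symmetric part in
`s`, `X`; twice the gap is `hanti` plus `hsym`. -/
theorem two_missing_inequality {n : ℕ} (hn : 4 ≤ n) {u v x r S Y : ℝ} (hS : S = -(u + v) / 2)
    (hY : (S - (x + r)) ^ 2 ≤ (n - 2 : ℝ) * (Y - (x ^ 2 + r ^ 2))) (hY0 : x ^ 2 + r ^ 2 ≤ Y) :
    (n - 2 : ℝ) * Y + (u + v) ^ 2 + S ^ 2 + (u + r) ^ 2 + (v + x) ^ 2 ≤
      (n - 11 / 20 : ℝ) * (u ^ 2 + v ^ 2 + Y) := by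
  subst hS
  obtain ⟨s, hs⟩ : ∃ s, s = u + v := ⟨_, rfl⟩
  obtain ⟨d, hd⟩ : ∃ d, d = u - v := ⟨_, rfl⟩
  obtain ⟨X, hX⟩ : ∃ X, X = x + r := ⟨_, rfl⟩
  obtain ⟨D, hD⟩ : ∃ D, D = x - r := ⟨_, rfl⟩
  obtain rfl : u = (s + d) / 2 := by linarith
  obtain rfl : v = (s - d) / 2 := by linarith
  obtain rfl : x = (X + D) / 2 := by linarith
  obtain rfl : r = (X - D) / 2 := by linarith
  clear hs hd hX hD
  have hn4 : (4 : ℝ) ≤ n := by exact_mod_cast hn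
  have hanti : 0 ≤ 9 / 20 * D ^ 2 + 2 * d * D + (n - 31 / 20 : ℝ) * d ^ 2 := by
    nlinarith [sq_nonneg (9 * D + 20 * d), mul_le_mul_of_nonneg_right hn4 (sq_nonneg d)]
  -- `t` is the square sum over the columns other than the two missed ones.
  obtain ⟨t, ht⟩ : ∃ t, t = Y - (((X + D) / 2) ^ 2 + ((X - D) / 2) ^ 2) := ⟨_, rfl⟩
  have ht0 : 0 ≤ t := by linarith
  have hXs : (X + s / 2) ^ 2 ≤ (n - 2 : ℝ) * t := by
    rw [ht]
    convert hY using 1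
    ring
  have hsym : 0 ≤ 9 / 20 * X ^ 2 + 29 / 10 * t - 2 * s * X + (n - 81 / 20 : ℝ) * s ^ 2 := by
    clear hY hY0 hanti ht
    obtain rfl | rfl | rfl | hn7 : n = 4 ∨ n = 5 ∨ n = 6 ∨ 7 ≤ n := by omega
    · norm_num at hXs ⊢
      nlinarith [sq_nonneg (38 * X - 6 * s), sq_nonneg s]
    · norm_num at hXs ⊢
      nlinarith [sq_nonneg (14 * X - 5 * s), sq_nonneg s]
    · norm_num at hXs ⊢
      nlinarith [sq_nonneg (12 * X - 6 * s), sq_nonneg s]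
    · have hn7' : (7 : ℝ) ≤ n := by exact_mod_cast hn7
      nlinarith [sq_nonneg (9 * X - 20 * s), mul_le_mul_of_nonneg_right hn7' (sq_nonneg s)]
  obtain rfl : Y = t + (((X + D) / 2) ^ 2 + ((X - D) / 2) ^ 2) := by linarith
  clear hY hY0 ht hXs
  linarith

theorem q₂_compl_le_of_one_missing {w : β} (h0 : ∀ j, M 0 j = true)
    (h1 : ∀ j, M 1 j = decide (j ≠ w)) (hb : 4 ≤ Fintype.card β) :
    q₂ (bip M)ᶜ h ≤ Fintype.card β - 3 / 5 := by
  -- The normal imitates a leading eigenvector of the complement: 1 on the clique of columns, less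
  -- on the row attached to it by one edge.
  refine q₂_le_of_forall _ h (Sum.elim ![0, 1 / 2] 1) fun z hz => ?_
  have hz' : ∑ j, z (.inr j) = -z (.inl 1) / 2 := by
    simp [dotProduct, Fintype.sum_sum_type] at hz
    linarith
  have hY := sq_sum_sub_le (fun j => z (.inr j)) {w}
  simp only [Finset.sum_singleton, Finset.card_singleton, Nat.cast_one] at hY
  rw [compl_form_of_one_missing h0 h1, dotProduct_self_sum, Fin.sum_univ_two]
  exact one_missing_inequality hb hz' hY
    (Finset.single_le_sum (f := fun j => z (.inr j) ^ 2) (fun j _ => sq_nonneg _)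
      (Finset.mem_univ w))

theorem q₂_compl_le_of_two_single_missing {r w : β} (hrw : r ≠ w)
    (h0 : ∀ j, M 0 j = decide (j ≠ r)) (h1 : ∀ j, M 1 j = decide (j ≠ w))
    (hb : 4 ≤ Fintype.card β) : q₂ (bip M)ᶜ h ≤ Fintype.card β - 11 / 20 := by
  refine q₂_le_of_forall _ h (Sum.elim ![1 / 2, 1 / 2] 1) fun z hz => ?_
  have hz' : ∑ j, z (.inr j) = -(z (.inl 0) + z (.inl 1)) / 2 := by
    simp [dotProduct, Fintype.sum_sum_type] at hz
    linarith
  have hY := sq_sum_sub_le (fun j => z (.inr j)) {w, r}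
  rw [Finset.sum_pair hrw.symm, Finset.sum_pair hrw.symm, Finset.card_pair hrw.symm] at hY
  rw [compl_form_of_two_missing h0 h1, dotProduct_self_sum, Fin.sum_univ_two]
  refine two_missing_inequality hb hz' (by exact_mod_cast hY) ?_
  rw [← Finset.sum_pair (f := fun j => z (.inr j) ^ 2) hrw.symm]
  exact Finset.sum_le_sum_of_subset_of_nonneg (Finset.subset_univ _) fun j _ _ => sq_nonneg _

/-- Both bounds together for a connected spanning subgraph of `K_{2,b}`, `b ≥ 4`. -/
theorem q₂_add_q₂_compl_bip_fin_two_lt (M : Fin 2 → β → Bool) (hc : (bip M).Connected)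
    (hb : 4 ≤ Fintype.card β) :
    q₂ (bip M) h + q₂ (bip M)ᶜ h < 2 * (Fintype.card (Fin 2 ⊕ β) : ℝ) - 5 := by
  have hn : (Fintype.card (Fin 2 ⊕ β) : ℝ) = Fintype.card β + 2 := by
    rw [Fintype.card_sum, Fintype.card_fin]
    push_cast
    ring
  have hlt := q₂_compl_bip_lt M h hc (by rw [Fintype.card_fin]; omega)
  have hle := q₂_bip_le M h (by rw [Fintype.card_fin]; omega)
  rw [hn] at hlt ⊢
  obtain ⟨σ, hσ⟩ : ∃ σ : Equiv.Perm (Fin 2), σ = Equiv.swap 0 1 := ⟨_, rfl⟩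
  have hσ0 : σ 0 = 1 := by simp [hσ]
  have hσ1 : σ 1 = 0 := by simp [hσ]
  let N : Fin 2 → β → Bool := fun i j => M (σ i) ((Equiv.refl β) j)
  have e : bip N ≃g bip M := bipCongr M σ (Equiv.refl β)
  have hN0 : ∀ j, N 0 j = M 1 j := fun j => by simp [N, hσ0]
  have hN1 : ∀ j, N 1 j = M 0 j := fun j => by simp [N, hσ1]
  have heq := q₂_congr h e h
  have heq' := q₂_congr h (complIso e) h
  -- A column missed by both rows would be an isolated vertex. This is what separates `r` from `w`
  -- below.
  have hcol : ∀ j, M 0 j = true ∨ M 1 j = true := by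
    intro j
    by_contra hj
    push Not at hj
    have := bip_connected_induction hc (P := fun v => v = .inr j) rfl (fun i k hik => by
      constructor
      · rintro ⟨⟩
      · rintro ⟨⟩
        fin_cases i <;> simp_all) (.inl 0)
    exact absurd this (by simp)
  by_cases h1 : 2 ≤ (Finset.univ.filter fun j => M 1 j = false).card
  · linarith [q₂_bip_le_of_two_missing M h hb h1]
  by_cases h0 : 2 ≤ (Finset.univ.filter fun j => M 0 j = false).card
  · have := q₂_bip_le_of_two_missing N h hb (by simpa only [hN1] using h0)
    linarith
  have hrow : ∀ i, ¬ 2 ≤ (Finset.univ.filter fun j => M i j = false).card →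
      (∀ j, M i j = true) ∨ ∃ w, ∀ j, M i j = decide (j ≠ w) := by
    intro i hi
    rcases Nat.lt_or_ge 0 (Finset.univ.filter fun j => M i j = false).card with hpos | hz
    · right
      obtain ⟨w, hw⟩ := Finset.card_eq_one.1
        (show (Finset.univ.filter fun j => M i j = false).card = 1 by omega)
      refine ⟨w, fun j => ?_⟩
      have : M i j = false ↔ j = w := by
        have := congrArg (j ∈ ·) hw
        simpa using this
      by_cases hj : j = w
      · subst hj
        simpa using this
      · simpa [hj] using this
    · left
      intro j
      rw [ge_iff_le, Nat.le_zero, Finset.card_eq_zero] at hz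
      have := congrArg (j ∈ ·) hz
      simpa using this
  rcases hrow 0 h0 with f0 | ⟨r, f0⟩ <;> rcases hrow 1 h1 with f1 | ⟨w, f1⟩
  · linarith [q₂_compl_le_of_full h f0 f1 hb]
  · linarith [q₂_compl_le_of_one_missing h f0 f1 hb, q₂_bip_le_of_one_missing h f0 f1 hb]
  · have g0 : ∀ j, N 0 j = true := fun j => by rw [hN0, f1]
    have g1 : ∀ j, N 1 j = decide (j ≠ r) := fun j => by rw [hN1, f0]
    linarith [q₂_compl_le_of_one_missing h g0 g1 hb, q₂_bip_le_of_one_missing h g0 g1 hb]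
  · have hrw : r ≠ w := by
      rintro rfl
      have := hcol r
      simp [f0, f1] at this
    linarith [q₂_compl_le_of_two_single_missing h hrw f0 f1 hb,
      q₂_bip_le_of_two_single_missing h hrw f0 f1 hb]

end TwoRowsComplement

/-! ### The case a = b = 3: balanced vectors. -/

section ThreeByThree

/-- A nonzero vector on the two sides of a `3 × 3` biadjacency matrix with zero sum on either side
that is cancelled along every missing edge. Such vectors are the eigenvectors of the signless
Laplacian of `bip M` for the eigenvalue `3`. -/
def HasBalancedVector (M : Fin 3 → Fin 3 → Bool) : Prop :=
  ∃ p q : Fin 3 → ℝ, (p ≠ 0 ∨ q ≠ 0) ∧ ∑ i, p i = 0 ∧ ∑ j, q j = 0 ∧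
    ∀ i j, M i j = false → p i + q j = 0

theorem HasBalancedVector.of_int {M : Fin 3 → Fin 3 → Bool} (p q : Fin 3 → ℤ)
    (h0 : p ≠ 0 ∨ q ≠ 0) (hp : ∑ i, p i = 0) (hq : ∑ j, q j = 0)
    (hpq : ∀ i j, M i j = false → p i + q j = 0) : HasBalancedVector M := by
  refine ⟨fun i => (p i : ℝ), fun j => (q j : ℝ), ?_, ?_, ?_, fun i j hij => ?_⟩
  · refine h0.imp (fun h hp => h (funext fun i => ?_)) (fun h hq => h (funext fun i => ?_))
    · simpa using congrFun hp i
    · simpa using congrFun hq i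
  · simpa using congrArg (Int.cast : ℤ → ℝ) hp
  · simpa using congrArg (Int.cast : ℤ → ℝ) hq
  · simpa using congrArg (Int.cast : ℤ → ℝ) (hpq i j hij)

theorem HasBalancedVector.comp_perm {M : Fin 3 → Fin 3 → Bool} (hM : HasBalancedVector M)
    (σ τ : Equiv.Perm (Fin 3)) : HasBalancedVector (fun i j => M (σ i) (τ j)) := by
  obtain ⟨p, q, h0, hp, hq, hpq⟩ := hM
  refine ⟨fun i => p (σ i), fun j => q (τ j), ?_, (Equiv.sum_comp σ p).trans hp,
    (Equiv.sum_comp τ q).trans hq,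
    fun i j hij => hpq _ _ hij⟩
  refine h0.imp (fun h hp => h (funext fun i => ?_)) (fun h hq => h (funext fun i => ?_))
  · simpa using congrFun hp (σ.symm i)
  · simpa using congrFun hq (τ.symm i)

theorem HasBalancedVector.transpose {M : Fin 3 → Fin 3 → Bool} (hM : HasBalancedVector M) :
    HasBalancedVector (fun i j => M j i) := by
  obtain ⟨p, q, h0, hp, hq, hpq⟩ := hM
  exact ⟨q, p, h0.symm, hq, hp, fun i j hij => by rw [add_comm, hpq _ _ hij]⟩

variable (M : Fin 3 → Fin 3 → Bool) (h : 1 < Fintype.card (Fin 3 ⊕ Fin 3))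

/-- On vectors of total sum 0 the form is `3|z|²` minus twice the squared row sum minus the squares
of the missing edges. If it reaches `3|z|²`, both losses vanish. -/
theorem hasBalancedVector_of_le_q₂ (h3 : 3 ≤ q₂ (bip M) h) : HasBalancedVector M := by
  obtain ⟨z, hz0, hz1, hz⟩ :=
    (isHermitian_signlessLapMatrix (bip M)).exists_second_eigenvalue_le h 1
  change q₂ (bip M) h * _ ≤ _ at hz
  have hzz : 0 ≤ z ⬝ᵥ z := Finset.sum_nonneg fun i _ => mul_self_nonneg _
  have hz2 := (mul_le_mul_of_nonneg_right h3 hzz).trans hz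
  have hz' : ∑ i, z (.inl i) + ∑ j, z (.inr j) = 0 := by
    simpa [dotProduct, Fintype.sum_sum_type] using hz1
  have hnn : ∀ i j, 0 ≤ if M i j then 0 else (z (.inl i) + z (.inr j)) ^ 2 := fun i j => by
    split_ifs <;> positivity
  have hm := sum_missing_nonneg M z
  rw [bip_form_eq_sub, dotProduct_self_sum] at hz2
  simp only [Fintype.card_fin, Nat.cast_ofNat] at hz2
  have hp : ∑ i, z (.inl i) = 0 := by
    have : (∑ i, z (.inl i)) ^ 2 ≤ 0 := by
      have e : ∑ j, z (.inr j) = -∑ i, z (.inl i) := by linarith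
      rw [e] at hz2
      nlinarith
    exact pow_eq_zero_iff two_ne_zero |>.1 (le_antisymm this (sq_nonneg _))
  have hq : ∑ j, z (.inr j) = 0 := by linarith
  have hs : ∑ i, ∑ j, (if M i j then 0 else (z (.inl i) + z (.inr j)) ^ 2) = 0 := by
    rw [hp] at hz2
    linarith
  refine ⟨fun i => z (.inl i), fun j => z (.inr j), ?_, hp, hq, fun i j hij => ?_⟩
  · by_contra hcon
    push Not at hcon
    refine hz0 (funext ?_)
    rintro (i | j)
    · exact congrFun hcon.1 i
    · exact congrFun hcon.2 j
  · rw [Finset.sum_eq_zero_iff_of_nonneg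
      fun i _ => Finset.sum_nonneg fun j _ => hnn i j] at hs
    have h1 := hs i (Finset.mem_univ i)
    rw [Finset.sum_eq_zero_iff_of_nonneg fun j _ => hnn i j] at h1
    have h2 := h1 j (Finset.mem_univ j)
    rw [if_neg (by simp [hij])] at h2
    exact pow_eq_zero_iff two_ne_zero |>.1 h2

-- The test plane is spanned by the constant vector and the balanced one. The constant part gains
-- 18s² over `3|x|²` and loses 4s² per missing edge, so four missing edges are affordable.
variable {M} in
theorem HasBalancedVector.le_q₂ (hM : HasBalancedVector M)
    (hcount : ∑ i, ∑ j, (if M i j then 0 else 1) ≤ 4) : 3 ≤ q₂ (bip M) h := by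
  obtain ⟨p, q, h0, hp, hq, hpq⟩ := hM
  refine le_q₂_of_forall _ h 1 (Sum.elim p q) (fun s t hst => ?_) fun s t => ?_
  · have hl : ∀ i, s + t * p i = 0 := fun i => by simpa using congrFun hst (.inl i)
    have hr : ∀ i, s + t * q i = 0 := fun i => by simpa using congrFun hst (.inr i)
    have hs : s = 0 := by
      have : ∑ i, (s + t * p i) = 0 := Finset.sum_eq_zero fun i _ => hl i
      rw [Finset.sum_add_distrib, ← Finset.mul_sum, hp] at this
      simpa using this
    refine ⟨hs, ?_⟩
    by_contra ht
    subst hs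
    simp only [zero_add, mul_eq_zero, ht, false_or] at hl hr
    rcases h0 with h0 | h0
    · exact h0 (funext hl)
    · exact h0 (funext hr)
  · have hsum : ∀ i j, (if M i j then (0 : ℝ) else ((s + t * p i) + (s + t * q j)) ^ 2) =
        4 * s ^ 2 * ((if M i j then 0 else 1 : ℕ) : ℝ) := by
      intro i j
      cases hij : M i j
      · have := hpq i j hij
        have e : (s + t * p i) + (s + t * q j) = 2 * s := by linear_combination t * this
        simp [e]
        ring
      · simp
    have hcount' : ((∑ i, ∑ j, (if M i j then 0 else 1) : ℕ) : ℝ) ≤ 4 := by exact_mod_cast hcount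
    rw [bip_form_eq_sub, dotProduct_self_sum]
    simp only [Pi.add_apply, Pi.smul_apply, Pi.one_apply, Sum.elim_inl, Sum.elim_inr, smul_eq_mul,
      mul_one, hsum, ← Finset.mul_sum, ← Nat.cast_sum, Finset.sum_add_distrib, hp, hq]
    simp only [Finset.sum_const, Finset.card_univ, Fintype.card_fin, nsmul_eq_mul,
      Nat.cast_ofNat]
    nlinarith [mul_le_mul_of_nonneg_left hcount' (sq_nonneg s), sq_nonneg s]

/-! ### Enumeration of the connected 3 × 3 biadjacency matrices. -/

/-- The `3 × 3` Boolean matrix whose rows, read one after the other, are the binary digits of `n`,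
least significant first. -/
def bitMatrix (n : ℕ) : Fin 3 → Fin 3 → Bool := fun i j => n.testBit (3 * i + j)

/-- The biadjacency matrices of `H₁, …, H₈` and `K_{3,3}`. -/
def extremalCodes : List ℕ := [307, 79, 315, 187, 238, 475, 443, 255, 511]

theorem hasBalancedVector_of_mem {n : ℕ} (hn : n ∈ extremalCodes) :
    HasBalancedVector (bitMatrix n) := by
  simp only [extremalCodes, List.mem_cons, List.not_mem_nil, or_false] at hn
  rcases hn with rfl | rfl | rfl | rfl | rfl | rfl | rfl | rfl | rfl
  · exact .of_int ![2, -1, -1] ![1, 1, -2] (by decide) (by decide) (by decide) (by decide)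
  · exact .of_int ![2, -1, -1] ![-2, 1, 1] (by decide) (by decide) (by decide) (by decide)
  · exact .of_int ![2, -1, -1] ![1, 1, -2] (by decide) (by decide) (by decide) (by decide)
  · exact .of_int ![1, -2, 1] ![-1, 2, -1] (by decide) (by decide) (by decide) (by decide)
  · exact .of_int ![0, 1, -1] ![0, -1, 1] (by decide) (by decide) (by decide) (by decide)
  · exact .of_int ![0, 0, 0] ![1, -1, 0] (by decide) (by decide) (by decide) (by decide)
  · exact .of_int ![0, 1, -1] ![1, -1, 0] (by decide) (by decide) (by decide) (by decide)
  · exact .of_int ![0, 0, 0] ![1, -1, 0] (by decide) (by decide) (by decide) (by decide)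
  · exact .of_int ![0, 0, 0] ![0, 1, -1] (by decide) (by decide) (by decide) (by decide)

theorem missing_le_four_of_mem :
    ∀ n ∈ extremalCodes, ∑ i, ∑ j, (if bitMatrix n i j then 0 else 1) ≤ 4 := by
  decide

/-- The spider with legs of lengths `1, 2, 2` has no balanced vector. -/
theorem not_hasBalancedVector_spider : ¬HasBalancedVector (bitMatrix 468) := by
  rintro ⟨p, q, h0, hp, hq, hpq⟩
  have e : ∀ i j, bitMatrix 468 i j = false → p i + q j = 0 := hpq
  have e00 := e 0 0 (by decide)
  have e01 := e 0 1 (by decide)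
  have e10 := e 1 0 (by decide)
  have e12 := e 1 2 (by decide)
  rw [Fin.sum_univ_three] at hp hq
  have a0 : p 0 = 0 := by linarith
  have a1 : p 1 = 0 := by linarith
  rcases h0 with h0 | h0 <;> refine h0 (funext fun i => ?_) <;> fin_cases i <;> simp <;> linarith

/-- The number with the given binary digits, least significant first. -/
def ofBits (a b c d e f g k l : Bool) : ℕ :=
  a.toNat + 2 * b.toNat + 4 * c.toNat + 8 * d.toNat + 16 * e.toNat + 32 * f.toNat +
  64 * g.toNat + 128 * k.toNat + 256 * l.toNat

theorem ofBits_spec : ∀ a b c d e f g k l : Bool, ofBits a b c d e f g k l < 512 ∧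
    (ofBits a b c d e f g k l).testBit 0 = a ∧ (ofBits a b c d e f g k l).testBit 1 = b ∧
    (ofBits a b c d e f g k l).testBit 2 = c ∧ (ofBits a b c d e f g k l).testBit 3 = d ∧
    (ofBits a b c d e f g k l).testBit 4 = e ∧ (ofBits a b c d e f g k l).testBit 5 = f ∧
    (ofBits a b c d e f g k l).testBit 6 = g ∧ (ofBits a b c d e f g k l).testBit 7 = k ∧
    (ofBits a b c d e f g k l).testBit 8 = l := by
  decide +kernel

/-- The inverse of `bitMatrix`. -/
def matrixCode (A : Fin 3 → Fin 3 → Bool) : ℕ :=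
  ofBits (A 0 0) (A 0 1) (A 0 2) (A 1 0) (A 1 1) (A 1 2) (A 2 0) (A 2 1) (A 2 2)

theorem matrixCode_lt (A : Fin 3 → Fin 3 → Bool) : matrixCode A < 512 :=
  (ofBits_spec _ _ _ _ _ _ _ _ _).1

theorem bitMatrix_matrixCode (A : Fin 3 → Fin 3 → Bool) : bitMatrix (matrixCode A) = A := by
  obtain ⟨-, h0, h1, h2, h3, h4, h5, h6, h7, h8⟩ := ofBits_spec (A 0 0) (A 0 1) (A 0 2)
    (A 1 0) (A 1 1) (A 1 2) (A 2 0) (A 2 1) (A 2 2)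
  funext i j
  fin_cases i <;> fin_cases j <;> assumption

/-- Whether the labels `s` and `t` agree along every edge of `bip (bitMatrix m)`. -/
def isLabelling (m : ℕ) (s₀ s₁ s₂ t₀ t₁ t₂ : Bool) : Bool :=
  (!m.testBit 0 || s₀ == t₀) && (!m.testBit 1 || s₀ == t₁) && (!m.testBit 2 || s₀ == t₂) &&
  (!m.testBit 3 || s₁ == t₀) && (!m.testBit 4 || s₁ == t₁) && (!m.testBit 5 || s₁ == t₂) &&
  (!m.testBit 6 || s₂ == t₀) && (!m.testBit 7 || s₂ == t₁) && (!m.testBit 8 || s₂ == t₂)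

/-- Whether every labelling that agrees along the edges of `bip (bitMatrix m)` is constant. -/
def isConnected (m : ℕ) : Bool :=
  [false, true].all fun s₁ => [false, true].all fun s₂ => [false, true].all fun t₀ =>
  [false, true].all fun t₁ => [false, true].all fun t₂ =>
    (s₁ && s₂ && t₀ && t₁ && t₂) || !isLabelling m true s₁ s₂ t₀ t₁ t₂

theorem isConnected_of_connected {m : ℕ} (hc : (bip (bitMatrix m)).Connected) :
    isConnected m = true := by
  simp only [isConnected, List.all_eq_true, Bool.or_eq_true, Bool.not_eq_true']
  intro s₁ _ s₂ _ t₀ _ t₁ _ t₂ _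
  by_contra! hcon
  obtain ⟨hcon, hlab⟩ := hcon
  rw [Ne, Bool.not_eq_false] at hlab
  refine hcon ?_
  -- Row 0 has the fixed label `true`, which connectedness propagates to every vertex.
  have hall := bip_connected_induction hc
    (P := fun v => Sum.elim ![true, s₁, s₂] ![t₀, t₁, t₂] v = true) (v₀ := .inl 0) rfl
    (fun i j hij => by
      simp only [isLabelling, Bool.and_eq_true, Bool.or_eq_true, Bool.not_eq_true',
        beq_iff_eq] at hlab
      simp only [bitMatrix] at hij
      simp only [Sum.elim_inl, Sum.elim_inr]
      fin_cases i <;> fin_cases j <;> simp_all)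
  simpa using And.intro (And.intro (And.intro (And.intro (hall (.inl 1)) (hall (.inl 2)))
    (hall (.inr 0))) (hall (.inr 1))) (hall (.inr 2))

/-- The permutations of `{0, 1, 2}`, as triples of values. -/
def permTriples : List (ℕ × ℕ × ℕ) :=
  [(0, 1, 2), (0, 2, 1), (1, 0, 2), (1, 2, 0), (2, 0, 1), (2, 1, 0)]

theorem exists_perm_of_mem : ∀ x ∈ permTriples, ∃ σ : Equiv.Perm (Fin 3),
    (σ 0 : ℕ) = x.1 ∧ (σ 1 : ℕ) = x.2.1 ∧ (σ 2 : ℕ) = x.2.2 := by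
  decide

/-- The code of `bitMatrix m` with its rows permuted by `x` and its columns by `y`. -/
def permCode (m : ℕ) (x y : ℕ × ℕ × ℕ) : ℕ :=
  ofBits (m.testBit (3 * x.1 + y.1)) (m.testBit (3 * x.1 + y.2.1)) (m.testBit (3 * x.1 + y.2.2))
    (m.testBit (3 * x.2.1 + y.1)) (m.testBit (3 * x.2.1 + y.2.1)) (m.testBit (3 * x.2.1 + y.2.2))
    (m.testBit (3 * x.2.2 + y.1)) (m.testBit (3 * x.2.2 + y.2.1)) (m.testBit (3 * x.2.2 + y.2.2))

/-- The code of the transpose of `bitMatrix m` with its columns permuted by `x` and its rows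
by `y`. -/
def permCodeTranspose (m : ℕ) (x y : ℕ × ℕ × ℕ) : ℕ :=
  ofBits (m.testBit (3 * x.1 + y.1)) (m.testBit (3 * x.2.1 + y.1)) (m.testBit (3 * x.2.2 + y.1))
    (m.testBit (3 * x.1 + y.2.1)) (m.testBit (3 * x.2.1 + y.2.1)) (m.testBit (3 * x.2.2 + y.2.1))
    (m.testBit (3 * x.1 + y.2.2)) (m.testBit (3 * x.2.1 + y.2.2)) (m.testBit (3 * x.2.2 + y.2.2))

/-- Whether `bitMatrix m` is, up to the order of its rows and columns and up to transposition, one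
of the extremal matrices or the spider. -/
def isListed (m : ℕ) : Bool :=
  permTriples.any fun x => permTriples.any fun y =>
    (468 :: extremalCodes).any fun n => n.beq (permCode m x y) || n.beq (permCodeTranspose m x y)

/-- A finite check over all 512 matrices; matrices and permutations are encoded by natural numbers
so that the kernel can evaluate it. -/
theorem isListed_of_isConnected : ∀ m < 512, (!isConnected m || isListed m) = true := by
  decide +kernel

/-- Balanced vectors survive permutation and transposition, so the listed representative has one
too, which rules out the spider. -/
theorem exists_code_of_hasBalancedVector (hc : (bip M).Connected) (hM : HasBalancedVector M) :
    ∃ n ∈ extremalCodes, Nonempty (bip M ≃g bip (bitMatrix n)) := by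
  obtain ⟨m, hm, rfl⟩ : ∃ m < 512, bitMatrix m = M :=
    ⟨_, matrixCode_lt M, bitMatrix_matrixCode M⟩
  have hl := isListed_of_isConnected m hm
  simp only [isConnected_of_connected hc, Bool.not_true, Bool.false_or, isListed,
    List.any_eq_true, Bool.or_eq_true] at hl
  obtain ⟨x, hx, y, hy, n, hn, hxy⟩ := hl
  obtain ⟨σ, hσ0, hσ1, hσ2⟩ := exists_perm_of_mem x hx
  obtain ⟨τ, hτ0, hτ1, hτ2⟩ := exists_perm_of_mem y hy
  have hcomp := hM.comp_perm σ τ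
  have key : HasBalancedVector (bitMatrix n) ∧
      Nonempty (bip (bitMatrix m) ≃g bip (bitMatrix n)) := by
    rcases hxy with hxy | hxy
    · have e : permCode m x y = matrixCode fun i j => bitMatrix m (σ i) (τ j) := by
        simp only [permCode, matrixCode, bitMatrix, hσ0, hσ1, hσ2, hτ0, hτ1, hτ2]
      rw [Nat.eq_of_beq_eq_true hxy, e, bitMatrix_matrixCode]
      exact ⟨hcomp, ⟨(bipCongr _ σ τ).symm⟩⟩
    · have e : permCodeTranspose m x y = matrixCode fun i j => bitMatrix m (σ j) (τ i) := by
        simp only [permCodeTranspose, matrixCode, bitMatrix, hσ0, hσ1, hσ2, hτ0, hτ1, hτ2]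
      rw [Nat.eq_of_beq_eq_true hxy, e, bitMatrix_matrixCode]
      exact ⟨hcomp.transpose,
        ⟨((bipSwap fun i j => bitMatrix m (σ i) (τ j)).trans (bipCongr _ σ τ)).symm⟩⟩
  rcases List.mem_cons.1 hn with rfl | hn
  · exact absurd key.1 not_hasBalancedVector_spider
  · exact ⟨n, hn, key.2⟩

end ThreeByThree

/-! ### Assembly: all class sizes, and the equality case. -/

section Main

/-- A properly two-coloured graph as a biadjacency matrix between its colour classes. -/
def isoBip {V : Type*} (G : SimpleGraph V) [DecidableRel G.Adj] (p : V → Prop) [DecidablePred p]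
    (hp : ∀ v w, G.Adj v w → (p v ↔ ¬p w)) :
    bip (fun (i : {v // p v}) (j : {v // ¬p v}) => decide (G.Adj i j)) ≃g G where
  toEquiv := Equiv.sumCompl p
  map_rel_iff' := by
    rintro (⟨i, hi⟩ | ⟨i, hi⟩) (⟨j, hj⟩ | ⟨j, hj⟩)
    · simpa using fun hij => (hp i j hij).1 hi hj
    · simp
    · simp [G.adj_comm]
    · simpa using fun hij => hi ((hp i j hij).2 hj)

theorem q₂_add_q₂_compl_bip_le {α β : Type*} [Fintype α] [Fintype β] [DecidableEq α]
    [DecidableEq β] (M : α → β → Bool) (h : 1 < Fintype.card (α ⊕ β)) (hc : (bip M).Connected)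
    (hab : Fintype.card α ≤ Fintype.card β) (hn : 6 ≤ Fintype.card (α ⊕ β)) :
    q₂ (bip M) h + q₂ (bip M)ᶜ h ≤ 2 * (Fintype.card (α ⊕ β) : ℝ) - 5 ∧
    (q₂ (bip M) h + q₂ (bip M)ᶜ h = 2 * (Fintype.card (α ⊕ β) : ℝ) - 5 →
      Fintype.card α = 3 ∧ Fintype.card β = 3) := by
  have hcard : Fintype.card (α ⊕ β) = Fintype.card α + Fintype.card β := Fintype.card_sum
  have hle := q₂_bip_le M h hab
  have hcle := q₂_compl_le (bip M) h
  have hn' : (6 : ℝ) ≤ Fintype.card (α ⊕ β) := by exact_mod_cast hn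
  obtain h0 | h1 | h2 | h3 : Fintype.card α = 0 ∨ Fintype.card α = 1 ∨ Fintype.card α = 2 ∨
      3 ≤ Fintype.card α := by omega
  · exfalso
    have : IsEmpty α := Fintype.card_eq_zero_iff.1 h0
    obtain ⟨x, y, hxy⟩ := Fintype.exists_pair_of_one_lt_card h
    -- With no rows there are no edges, so the induction step is vacuous and connectedness
    -- identifies any two vertices.
    exact hxy (bip_connected_induction hc (P := fun v => v = y) rfl (fun i => isEmptyElim i) x)
  · have := q₂_bip_le_one M h h1
    refine ⟨by linarith, fun heq => ?_⟩
    linarith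
  · let σ : Fin 2 ≃ α := (Fintype.equivFinOfCardEq h2).symm
    let e := bipCongr M σ (Equiv.refl β)
    have hcard2 : Fintype.card (Fin 2 ⊕ β) = Fintype.card (α ⊕ β) := by
      rw [hcard, Fintype.card_sum, Fintype.card_fin, h2]
    have hlt := q₂_add_q₂_compl_bip_fin_two_lt (hcard2 ▸ h)
      (fun i j => M (σ i) (Equiv.refl β j)) (e.connected_iff.2 hc) (by omega)
    rw [q₂_congr _ e h, q₂_congr _ (complIso e) h, hcard2] at hlt
    exact ⟨hlt.le, fun heq => absurd heq hlt.ne⟩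
  · have hb : (Fintype.card β : ℝ) + 3 ≤ Fintype.card (α ⊕ β) := by
      rw [hcard]
      push_cast
      have : (3 : ℝ) ≤ Fintype.card α := by exact_mod_cast h3
      linarith
    refine ⟨by linarith, fun heq => ?_⟩
    have hαβ : Fintype.card α = Fintype.card β := by
      by_contra hne
      linarith [q₂_compl_bip_lt M h hc hne]
    have hb' : (Fintype.card β : ℝ) + 3 = Fintype.card (α ⊕ β) := by linarith
    have : Fintype.card β + 3 = Fintype.card (α ⊕ β) := by exact_mod_cast hb'
    omega

/-- Upper and lower bounds meet: `q₂` is 3 for the graph and 4 for its complement. -/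
theorem q₂_add_q₂_compl_of_mem {n : ℕ} (hn : n ∈ extremalCodes)
    (h : 1 < Fintype.card (Fin 3 ⊕ Fin 3)) :
    q₂ (bip (bitMatrix n)) h + q₂ (bip (bitMatrix n))ᶜ h = 7 := by
  have h1 := q₂_bip_le (bitMatrix n) h le_rfl
  have h2 := (hasBalancedVector_of_mem hn).le_q₂ h (missing_le_four_of_mem n hn)
  have h3 := q₂_compl_le (bip (bitMatrix n)) h
  have h4 := le_q₂_compl_bip (bitMatrix n) h rfl
  norm_num at h1 h3 h4
  linarith

theorem exists_iso_bip {V : Type*} [Fintype V] (G : SimpleGraph V) [DecidableRel G.Adj]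
    (hbip : G.IsBipartite) :
    ∃ (p : V → Prop) (_ : DecidablePred p) (M : {v // p v} → {v // ¬p v} → Bool),
      Fintype.card {v // p v} ≤ Fintype.card {v // ¬p v} ∧ Nonempty (G ≃g bip M) := by
  obtain ⟨c⟩ := hbip
  have hne : ∀ v w, G.Adj v w → (c v = 0 ↔ ¬c w = 0) := by
    intro v w hvw
    have := c.valid hvw
    revert this
    generalize c v = a
    generalize c w = b
    fin_cases a <;> fin_cases b <;> simp
  rcases le_total (Fintype.card {v // c v = 0}) (Fintype.card {v // ¬c v = 0}) with hle | hle
  · exact ⟨_, _, _, hle, ⟨(isoBip G _ hne).symm⟩⟩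
  · refine ⟨fun v => ¬c v = 0, inferInstance, _, ?_,
      ⟨(isoBip G (fun v => ¬c v = 0) fun v w hvw => ?_).symm⟩⟩
    · simpa only [not_not] using hle
    · rw [hne v w hvw]

theorem equality_iff_exists_code {V : Type*} [Fintype V] [DecidableEq V] (G : SimpleGraph V)
    [DecidableRel G.Adj] (h : 1 < Fintype.card V) (hn : 6 ≤ Fintype.card V)
    (hconn : G.Connected) (hbip : G.IsBipartite) :
    q₂ G h + q₂ Gᶜ h ≤ 2 * (Fintype.card V : ℝ) - 5 ∧
    (q₂ G h + q₂ Gᶜ h = 2 * (Fintype.card V : ℝ) - 5 ↔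
      ∃ n ∈ extremalCodes, Nonempty (G ≃g bip (bitMatrix n))) := by
  obtain ⟨p, _, M, hle, ⟨e⟩⟩ := exists_iso_bip G hbip
  have hcard := Fintype.card_congr e.toEquiv
  have hc : (bip M).Connected := e.connected_iff.1 hconn
  have hmain := q₂_add_q₂_compl_bip_le M (hcard ▸ h) hc hle (hcard ▸ hn)
  rw [← q₂_congr h e, ← q₂_congr h (complIso e), ← hcard] at hmain
  refine ⟨hmain.1, fun heq => ?_, ?_⟩
  · obtain ⟨hα, hβ⟩ := hmain.2 heq
    let f := bipCongr M (Fintype.equivFinOfCardEq hα).symm (Fintype.equivFinOfCardEq hβ).symm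
    have h6 : 1 < Fintype.card (Fin 3 ⊕ Fin 3) := by simp
    have hV : Fintype.card V = 6 := by rw [hcard, Fintype.card_sum, hα, hβ]
    rw [q₂_congr h (e.trans f.symm) h6, q₂_congr h (complIso (e.trans f.symm)) h6, hV] at heq
    -- The complement contributes at most 4, so a total of 7 forces at least 3 from the graph.
    have h3 := q₂_compl_le (bip fun i j => M ((Fintype.equivFinOfCardEq hα).symm i)
      ((Fintype.equivFinOfCardEq hβ).symm j)) h6
    have hbal := hasBalancedVector_of_le_q₂ _ h6 (by
      norm_num at heq h3
      linarith)
    obtain ⟨n, hmem, ⟨g⟩⟩ := exists_code_of_hasBalancedVector _ (f.connected_iff.2 hc) hbal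
    exact ⟨n, hmem, ⟨(e.trans f.symm).trans g⟩⟩
  · rintro ⟨n, hmem, ⟨g⟩⟩
    have h6 : 1 < Fintype.card (Fin 3 ⊕ Fin 3) := by simp
    rw [q₂_congr h g h6, q₂_congr h (complIso g) h6, q₂_add_q₂_compl_of_mem hmem,
      Fintype.card_congr g.toEquiv]
    norm_num

/-! ### Identification of the nine codes with the named graphs. -/

/-- Graphs on `Fin 6` that agree with a biadjacency matrix between `{0, 1, 2}` and `{3, 4, 5}`. -/
theorem nonempty_iso_bip {H : SimpleGraph (Fin 6)} {M : Fin 3 → Fin 3 → Bool}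
    (hH : ∀ a b : Fin 6, H.Adj a b ↔
      (bip M).Adj ((finSumFinEquiv (m := 3) (n := 3)).symm a)
        ((finSumFinEquiv (m := 3) (n := 3)).symm b)) : Nonempty (H ≃g bip M) :=
  ⟨⟨(finSumFinEquiv (m := 3) (n := 3)).symm, fun {a b} => (hH a b).symm⟩⟩

theorem nonempty_iso_iff {V W W' : Type*} (G : SimpleGraph V) {H : SimpleGraph W}
    {H' : SimpleGraph W'}
    (hH : Nonempty (H ≃g H')) : Nonempty (G ≃g H) ↔ Nonempty (G ≃g H') :=
  ⟨fun ⟨e⟩ => hH.elim fun f => ⟨e.trans f⟩, fun ⟨e⟩ => hH.elim fun f => ⟨e.trans f.symm⟩⟩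

theorem nonempty_iso_H₁ : Nonempty (H₁ ≃g bip (bitMatrix 307)) := nonempty_iso_bip (by
  simp only [H₁, SimpleGraph.fromEdgeSet_adj, Set.mem_insert_iff, Set.mem_singleton_iff]; decide)

theorem nonempty_iso_H₂ : Nonempty (H₂ ≃g bip (bitMatrix 79)) := nonempty_iso_bip (by
  simp only [H₂, SimpleGraph.fromEdgeSet_adj, Set.mem_insert_iff, Set.mem_singleton_iff]; decide)

theorem nonempty_iso_H₃ : Nonempty (H₃ ≃g bip (bitMatrix 315)) := nonempty_iso_bip (by
  simp only [H₃, SimpleGraph.fromEdgeSet_adj, Set.mem_insert_iff, Set.mem_singleton_iff]; decide)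

theorem nonempty_iso_H₄ : Nonempty (H₄ ≃g bip (bitMatrix 187)) := nonempty_iso_bip (by
  simp only [H₄, SimpleGraph.fromEdgeSet_adj, Set.mem_insert_iff, Set.mem_singleton_iff]; decide)

theorem nonempty_iso_H₅ : Nonempty (H₅ ≃g bip (bitMatrix 238)) := nonempty_iso_bip (by
  simp only [H₅, SimpleGraph.fromEdgeSet_adj, Set.mem_insert_iff, Set.mem_singleton_iff]; decide)

theorem nonempty_iso_H₆ : Nonempty (H₆ ≃g bip (bitMatrix 475)) := nonempty_iso_bip (by
  simp only [H₆, SimpleGraph.fromEdgeSet_adj, Set.mem_insert_iff, Set.mem_singleton_iff]; decide)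

theorem nonempty_iso_H₇ : Nonempty (H₇ ≃g bip (bitMatrix 443)) := nonempty_iso_bip (by
  simp only [H₇, SimpleGraph.fromEdgeSet_adj, Set.mem_insert_iff, Set.mem_singleton_iff]; decide)

theorem nonempty_iso_H₈ : Nonempty (H₈ ≃g bip (bitMatrix 255)) := nonempty_iso_bip (by
  simp only [H₈, SimpleGraph.fromEdgeSet_adj, Set.mem_insert_iff, Set.mem_singleton_iff]; decide)

theorem nonempty_iso_completeBipartiteGraph :
    Nonempty (completeBipartiteGraph (Fin 3) (Fin 3) ≃g bip (bitMatrix 511)) := by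
  have hM : ∀ i j, bitMatrix 511 i j = true := by decide
  refine ⟨⟨Equiv.refl _, ?_⟩⟩
  rintro (i | i) (j | j) <;> simp [hM]

end Main

end SignlessLaplacian

theorem theorem4 {V : Type*} [Fintype V] [DecidableEq V] (G : SimpleGraph V)
    [DecidableRel G.Adj] (hn : 6 ≤ Fintype.card V) (hconn : G.Connected)
    (hbip : G.IsBipartite) :
    SignlessLaplacian.q₂ G (by omega) + SignlessLaplacian.q₂ Gᶜ (by omega) ≤
        2 * (Fintype.card V : ℝ) - 5 ∧
      (SignlessLaplacian.q₂ G (by omega) + SignlessLaplacian.q₂ Gᶜ (by omega) =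
          2 * (Fintype.card V : ℝ) - 5 ↔
        Nonempty (G ≃g SignlessLaplacian.H₁) ∨ Nonempty (G ≃g SignlessLaplacian.H₂) ∨
        Nonempty (G ≃g SignlessLaplacian.H₃) ∨ Nonempty (G ≃g SignlessLaplacian.H₄) ∨
        Nonempty (G ≃g SignlessLaplacian.H₅) ∨ Nonempty (G ≃g SignlessLaplacian.H₆) ∨
        Nonempty (G ≃g SignlessLaplacian.H₇) ∨ Nonempty (G ≃g SignlessLaplacian.H₈) ∨
        Nonempty (G ≃g completeBipartiteGraph (Fin 3) (Fin 3))) := by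
  have h := SignlessLaplacian.equality_iff_exists_code G (by omega) hn hconn hbip
  simp only [SignlessLaplacian.extremalCodes, List.mem_cons, List.not_mem_nil,
    or_false, exists_eq_or_imp, exists_eq_left] at h
  rwa [SignlessLaplacian.nonempty_iso_iff G SignlessLaplacian.nonempty_iso_H₁,
    SignlessLaplacian.nonempty_iso_iff G SignlessLaplacian.nonempty_iso_H₂,
    SignlessLaplacian.nonempty_iso_iff G SignlessLaplacian.nonempty_iso_H₃,
    SignlessLaplacian.nonempty_iso_iff G SignlessLaplacian.nonempty_iso_H₄,
    SignlessLaplacian.nonempty_iso_iff G SignlessLaplacian.nonempty_iso_H₅,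
    SignlessLaplacian.nonempty_iso_iff G SignlessLaplacian.nonempty_iso_H₆,
    SignlessLaplacian.nonempty_iso_iff G SignlessLaplacian.nonempty_iso_H₇,
    SignlessLaplacian.nonempty_iso_iff G SignlessLaplacian.nonempty_iso_H₈,
    SignlessLaplacian.nonempty_iso_iff G
      SignlessLaplacian.nonempty_iso_completeBipartiteGraph]
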